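/- Two permutations of $[n]=\{1,2,\ldots,n\}$, written as sequences, are called $k$-neighbor separated ($k\ge 2$) if there are two elements of $[n]$ that are neighbors in one of the permutations and are separated by exactly $k-2$ other elements in the other permutation. Let $P(n,k)$ denote the maximal number of pairwise $k$-neighbor separated permutations of $[n]$. **Theorem.** For every integer $k\ge 3$ the limit $P(k):=\lim_{n\to\infty}\sqrt[n]{P(n,k)}$ exists and is finite, and $$\liminf_{k\to\infty} P(k)\ \ge\ 2 .$$ -/

import Mathlib

namespace NeighborSep

/-- A permutation `σ` of `Fin n` is read as the sequence `σ 0, σ 1, …, σ (n - 1)`, so that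
`σ.symm x` is the position of the element `x`.  `SeparatedBy σ m x y` says that exactly `m` other
elements lie between the two elements `x` and `y` in that sequence, in either order. -/
def SeparatedBy {n : ℕ} (σ : Equiv.Perm (Fin n)) (m : ℕ) (x y : Fin n) : Prop :=
  (σ.symm x : ℕ) + (m + 1) = (σ.symm y : ℕ) ∨ (σ.symm y : ℕ) + (m + 1) = (σ.symm x : ℕ)

/-- `x` and `y` are neighbors in `σ`: no element lies between them. -/
def Neighbors {n : ℕ} (σ : Equiv.Perm (Fin n)) (x y : Fin n) : Prop :=
  SeparatedBy σ 0 x y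

/-- Two permutations are `k`-neighbor separated (the notion is meant for `k ≥ 2`) if some two
elements are neighbors in one of them and are separated by exactly `k - 2` other elements in the
other one. -/
def NeighborSeparated {n : ℕ} (k : ℕ) (σ τ : Equiv.Perm (Fin n)) : Prop :=
  ∃ x y : Fin n, (Neighbors σ x y ∧ SeparatedBy τ (k - 2) x y) ∨
    (Neighbors τ x y ∧ SeparatedBy σ (k - 2) x y)

open Classical in
/-- `P(n, k)`: the largest size of a set of pairwise `k`-neighbor separated permutations of an
`n`-element set. -/
noncomputable def maxFamily (n k : ℕ) : ℕ :=
  (Finset.univ.filter fun F : Finset (Equiv.Perm (Fin n)) =>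
    (F : Set (Equiv.Perm (Fin n))).Pairwise (NeighborSeparated k)).sup Finset.card

/-- The `n`-th root of `P(n, k)`. -/
noncomputable def rootMaxFamily (k n : ℕ) : ℝ :=
  (maxFamily n k : ℝ) ^ (1 / (n : ℝ))

/-- `P(k) = lim_{n → ∞} P(n, k)^(1/n)`. -/
noncomputable def growthRate (k : ℕ) : ℝ :=
  Filter.limUnder Filter.atTop (rootMaxFamily k)

end NeighborSep

namespace NeighborSep

open Filter Topology

/-! The limit exists by Fekete's lemma: `maxFamily_mul_le` gives supermultiplicativity and
`maxFamily_le` an exponential upper bound. For the lower bound put `m = k - 2` and view positions as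
a grid with `m` columns. A cluster of `l + 1` elements encodes `l` bits: each step goes one column
right, and one row down as well if the bit is 1, so the distance is `1` or `m + 1 = k - 1`.
Permutations whose words differ in some bit are therefore separated. Clusters with equal words stack
vertically without overlap, so all but a small part of the grid is filled (`exists_placement`). This
gives `2 ^ (l / (l + 1))` as `k → ∞`; then `l → ∞`. -/

theorem not_neighborSeparated_self {n k : ℕ} (hk : 3 ≤ k) (σ : Equiv.Perm (Fin n)) :
    ¬ NeighborSeparated k σ σ := by
  rintro ⟨x, y, h⟩
  simp only [Neighbors, SeparatedBy] at h
  omega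

theorem NeighborSeparated.symm {n k : ℕ} {σ τ : Equiv.Perm (Fin n)}
    (h : NeighborSeparated k σ τ) : NeighborSeparated k τ σ := by
  obtain ⟨x, y, h⟩ := h
  exact ⟨x, y, h.symm⟩

theorem card_le_maxFamily {n k : ℕ} (hk : 3 ≤ k) {ι : Type*} [Fintype ι]
    (f : ι → Equiv.Perm (Fin n))
    (hf : Pairwise fun i j => NeighborSeparated k (f i) (f j)) :
    Fintype.card ι ≤ maxFamily n k := by
  classical
  have hinj : Function.Injective f := by
    intro i j hij
    by_contra hne
    have := hf hne
    simp only [hij] at this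
    exact not_neighborSeparated_self hk _ this
  rw [← Finset.card_univ, ← Finset.card_image_of_injective _ hinj]
  refine Finset.le_sup (f := Finset.card) ?_
  simp only [Finset.mem_filter, Finset.mem_univ, true_and, Finset.coe_image, Finset.coe_univ,
    Set.image_univ]
  rintro _ ⟨i, rfl⟩ _ ⟨j, rfl⟩ hij
  exact hf fun h => hij (by rw [h])

theorem exists_card_eq_maxFamily (n k : ℕ) :
    ∃ F : Finset (Equiv.Perm (Fin n)),
      (F : Set (Equiv.Perm (Fin n))).Pairwise (NeighborSeparated k) ∧ F.card = maxFamily n k := by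
  classical
  obtain ⟨F, hF, h⟩ := Finset.exists_mem_eq_sup
    (Finset.univ.filter fun F : Finset (Equiv.Perm (Fin n)) =>
      (F : Set (Equiv.Perm (Fin n))).Pairwise (NeighborSeparated k)) ⟨∅, by simp⟩ Finset.card
  refine ⟨F, (Finset.mem_filter.1 hF).2, ?_⟩
  rw [← h]
  unfold maxFamily
  congr!

/-! ### Existence of the limit -/

theorem one_le_maxFamily {k : ℕ} (hk : 3 ≤ k) (n : ℕ) : 1 ≤ maxFamily n k := by
  simpa using card_le_maxFamily hk (fun _ : Unit => (1 : Equiv.Perm (Fin n)))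
    fun i j h => (h rfl).elim

/-- Colouring each element by its position modulo `k - 1` distinguishes the members of a
`k`-neighbor separated family. -/
theorem maxFamily_le {k : ℕ} (hk : 3 ≤ k) (n : ℕ) : maxFamily n k ≤ (k - 1) ^ n := by
  obtain ⟨F, hF, hcard⟩ := exists_card_eq_maxFamily n k
  have hpos : 0 < k - 1 := by omega
  let c : Equiv.Perm (Fin n) → Fin n → Fin (k - 1) :=
    fun σ x => ⟨(σ.symm x : ℕ) % (k - 1), Nat.mod_lt _ hpos⟩
  have key : ∀ σ τ : Equiv.Perm (Fin n), c σ = c τ → ∀ x y,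
      ¬ (Neighbors σ x y ∧ SeparatedBy τ (k - 2) x y) := by
    rintro σ τ h x y ⟨h₁, h₂⟩
    have hx : (σ.symm x : ℕ) ≡ τ.symm x [MOD k - 1] := congrArg Fin.val (congrFun h x)
    have hy : (σ.symm y : ℕ) ≡ τ.symm y [MOD k - 1] := congrArg Fin.val (congrFun h y)
    have hk2 : k - 2 + 1 = k - 1 := by omega
    simp only [Neighbors, SeparatedBy, hk2] at h₁ h₂
    have hxy : (τ.symm x : ℕ) ≡ τ.symm y [MOD k - 1] := by
      rcases h₂ with h₂ | h₂ <;> rw [← h₂] <;> simp [Nat.ModEq]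
    have hσ : (σ.symm x : ℕ) ≡ σ.symm y [MOD k - 1] := (hx.trans hxy).trans hy.symm
    -- Neighbors have residues differing by 1, which is nonzero because `k - 1 ≥ 2`.
    have hone : ∀ a b : ℕ, a ≡ b [MOD k - 1] → a + (0 + 1) = b → False := by
      intro a b hab h
      have h1 : a + 0 ≡ a + 1 [MOD k - 1] := by simpa [← h] using hab
      have h2 : (0 : ℕ) % (k - 1) = 1 % (k - 1) := Nat.ModEq.add_left_cancel' a h1
      rw [Nat.zero_mod, Nat.mod_eq_of_lt (by omega)] at h2
      omega
    rcases h₁ with h₁ | h₁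
    · exact hone _ _ hσ h₁
    · exact hone _ _ hσ.symm h₁
  have hinj : Set.InjOn c F := by
    intro σ hσ τ hτ h
    by_contra hne
    obtain ⟨x, y, h' | h'⟩ := hF hσ hτ hne
    · exact key σ τ h x y h'
    · exact key τ σ h.symm x y h'
  rw [← hcard]
  simpa using Finset.card_le_card_of_injOn c (t := Finset.univ) (fun _ _ => Finset.mem_univ _) hinj

/-- Juxtaposition of permutations makes `P(n, k)` supermultiplicative in `n`. -/
theorem maxFamily_mul_le {k : ℕ} (hk : 3 ≤ k) (n m : ℕ) :
    maxFamily n k * maxFamily m k ≤ maxFamily (n + m) k := by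
  obtain ⟨F, hF, hFc⟩ := exists_card_eq_maxFamily n k
  obtain ⟨G, hG, hGc⟩ := exists_card_eq_maxFamily m k
  rw [← hFc, ← hGc]
  let f : F × G → Equiv.Perm (Fin (n + m)) :=
    fun p => finSumFinEquiv.permCongr (Equiv.sumCongr p.1.1 p.2.1)
  have hl : ∀ p x, (((f p).symm (Fin.castAdd m x) : Fin (n + m)) : ℕ) = p.1.1.symm x := by
    intro p x
    simp [f, Equiv.permCongr_def]
  have hr : ∀ p x, (((f p).symm (Fin.natAdd n x) : Fin (n + m)) : ℕ) = n + p.2.1.symm x := by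
    intro p x
    simp [f, Equiv.permCongr_def]
  have := card_le_maxFamily hk f ?_
  · simpa using this
  rintro ⟨⟨σ, hσ⟩, ⟨τ, hτ⟩⟩ ⟨⟨σ', hσ'⟩, ⟨τ', hτ'⟩⟩ hne
  by_cases h : σ = σ'
  · have hτne : τ ≠ τ' := by rintro rfl; exact hne (by simp [h])
    obtain ⟨x, y, hxy⟩ := hG hτ hτ' hτne
    refine ⟨Fin.natAdd n x, Fin.natAdd n y, ?_⟩
    simp only [Neighbors, SeparatedBy, hr] at hxy ⊢
    omega
  · obtain ⟨x, y, hxy⟩ := hF hσ hσ' h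
    refine ⟨Fin.castAdd m x, Fin.castAdd m y, ?_⟩
    simpa only [Neighbors, SeparatedBy, hl] using hxy

theorem subadditive_neg_log_maxFamily {k : ℕ} (hk : 3 ≤ k) :
    Subadditive fun n => -Real.log (maxFamily n k) := by
  intro m n
  have hm : (0 : ℝ) < maxFamily m k := by exact_mod_cast one_le_maxFamily hk m
  have hn : (0 : ℝ) < maxFamily n k := by exact_mod_cast one_le_maxFamily hk n
  have h : (maxFamily m k : ℝ) * maxFamily n k ≤ maxFamily (m + n) k := by
    exact_mod_cast maxFamily_mul_le hk m n
  have := Real.log_le_log (mul_pos hm hn) h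
  rw [Real.log_mul hm.ne' hn.ne'] at this
  linarith

theorem bddBelow_neg_log_maxFamily {k : ℕ} (hk : 3 ≤ k) :
    BddBelow (Set.range fun n : ℕ => -Real.log (maxFamily n k) / n) := by
  refine ⟨-Real.log ((k - 1 : ℕ) : ℝ), ?_⟩
  rintro _ ⟨n, rfl⟩
  have hk1 : (1 : ℝ) ≤ ((k - 1 : ℕ) : ℝ) := by exact_mod_cast (by omega : 1 ≤ k - 1)
  rcases Nat.eq_zero_or_pos n with rfl | hn
  · simpa using Real.log_nonneg hk1
  have hn' : (0 : ℝ) < n := by exact_mod_cast hn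
  have hP : (0 : ℝ) < maxFamily n k := by exact_mod_cast one_le_maxFamily hk n
  have h : (maxFamily n k : ℝ) ≤ ((k - 1 : ℕ) : ℝ) ^ n := by exact_mod_cast maxFamily_le hk n
  have := Real.log_le_log hP h
  rw [Real.log_pow] at this
  dsimp only
  rw [le_div_iff₀ hn']
  linarith

theorem rootMaxFamily_eq_exp {k : ℕ} (hk : 3 ≤ k) (n : ℕ) :
    rootMaxFamily k n = Real.exp (-(-Real.log (maxFamily n k) / n)) := by
  have hP : (0 : ℝ) < maxFamily n k := by exact_mod_cast one_le_maxFamily hk n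
  rw [rootMaxFamily, Real.rpow_def_of_pos hP]
  congr 1
  ring

theorem tendsto_rootMaxFamily_exp {k : ℕ} (hk : 3 ≤ k) :
    Tendsto (rootMaxFamily k) atTop
      (𝓝 (Real.exp (-(subadditive_neg_log_maxFamily hk).lim))) := by
  rw [show rootMaxFamily k = _ from funext (rootMaxFamily_eq_exp hk)]
  exact (Real.continuous_exp.tendsto _).comp
    ((subadditive_neg_log_maxFamily hk).tendsto_lim (bddBelow_neg_log_maxFamily hk)).neg

theorem growthRate_eq_exp {k : ℕ} (hk : 3 ≤ k) :
    growthRate k = Real.exp (-(subadditive_neg_log_maxFamily hk).lim) :=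
  (tendsto_rootMaxFamily_exp hk).limUnder_eq

theorem tendsto_rootMaxFamily {k : ℕ} (hk : 3 ≤ k) :
    Tendsto (rootMaxFamily k) atTop (𝓝 (growthRate k)) := by
  rw [growthRate_eq_exp hk]
  exact tendsto_rootMaxFamily_exp hk

/-- In Fekete's lemma the limit is a supremum, so a construction for one `n` already bounds the
growth rate. -/
theorem rootMaxFamily_le_growthRate {k n : ℕ} (hk : 3 ≤ k) (hn : n ≠ 0) :
    rootMaxFamily k n ≤ growthRate k := by
  rw [growthRate_eq_exp hk, rootMaxFamily_eq_exp hk, Real.exp_le_exp, neg_le_neg_iff]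
  exact (subadditive_neg_log_maxFamily hk).lim_le_div (bddBelow_neg_log_maxFamily hk) hn

/-! ### Packing clusters into the grid -/

/-- Objects with finitely many shapes can be packed into `B` boxes of capacity `T`, each box
holding objects of a single shape only, as soon as `N + |S| T ≤ B T`. -/
theorem exists_packing {S : Type*} [Fintype S] {N B T : ℕ} (hT : 0 < T)
    (h : N + Fintype.card S * T ≤ B * T) (f : Fin N → S) :
    ∃ g : Fin N → Fin B × Fin T, Function.Injective g ∧
      ∀ i j, (g i).1 = (g j).1 → f i = f j := by
  classical
  let e : ∀ s, {i // f i = s} ≃ Fin (Fintype.card {i // f i = s}) := fun s => Fintype.equivFin _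
  -- The extra box takes the remainder of each shape; this costs the `|S| T` in the hypothesis.
  let b : S → ℕ := fun s => Fintype.card {i // f i = s} / T + 1
  have hN : ∑ s, Fintype.card {i // f i = s} = N := by
    rw [← Fintype.card_sigma, Fintype.card_congr (Equiv.sigmaFiberEquiv f), Fintype.card_fin]
  have hcard : Fintype.card (Σ s, Fin (b s)) ≤ Fintype.card (Fin B) := by
    simp only [Fintype.card_sigma, Fintype.card_fin]
    refine Nat.le_of_mul_le_mul_right ?_ hT
    calc (∑ s, b s) * T = ∑ s, (Fintype.card {i // f i = s} / T * T + T) := by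
          rw [Finset.sum_mul]
          exact Finset.sum_congr rfl fun s _ => by simp only [b]; ring
      _ ≤ ∑ s, (Fintype.card {i // f i = s} + T) :=
          Finset.sum_le_sum fun s _ => Nat.add_le_add_right (Nat.div_mul_le_self _ _) _
      _ = N + Fintype.card S * T := by
          rw [Finset.sum_add_distrib, hN]; simp
      _ ≤ B * T := h
  obtain ⟨φ⟩ := Function.Embedding.nonempty_of_card_le hcard
  -- Rank within the shape: its quotient by `T` selects the box, its remainder the slot.
  let r : Fin N → ℕ := fun i => e (f i) ⟨i, rfl⟩
  have hr : ∀ i, r i / T < b (f i) := fun i =>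
    Nat.lt_succ_of_le (Nat.div_le_div_right (e (f i) ⟨i, rfl⟩).2.le)
  have hr_inj : ∀ i j, f i = f j → r i = r j → i = j := by
    intro i j hij hrij
    have hcast : ∀ s (hs : f i = s), r i = e s ⟨i, hs⟩ := by rintro _ rfl; rfl
    rw [hcast _ hij] at hrij
    exact congrArg Subtype.val ((e (f j)).injective (Fin.ext hrij))
  refine ⟨fun i => (φ ⟨f i, ⟨r i / T, hr i⟩⟩, ⟨r i % T, Nat.mod_lt _ hT⟩), ?_, ?_⟩
  · intro i j hij
    simp only [Prod.mk.injEq, EmbeddingLike.apply_eq_iff_eq, Sigma.mk.injEq, Fin.mk.injEq] at hij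
    obtain ⟨⟨h₁, h₂⟩, h₃⟩ := hij
    refine hr_inj i j h₁ ?_
    have hdiv : r i / T = r j / T := by
      have hval : ∀ a c : ℕ, a = c → ∀ (p : Fin a) (q : Fin c), p ≍ q → (p : ℕ) = q := by
        rintro a _ rfl p q hpq
        rw [eq_of_heq hpq]
      exact hval _ _ (by rw [h₁]) _ _ h₂
    rw [← Nat.div_add_mod (r i) T, ← Nat.div_add_mod (r j) T, hdiv, h₃]
  · intro i j hij
    exact congrArg Sigma.fst (φ.injective hij)

/-- The number of `true` bits among the first `s` bits of `u`. -/
def onesBefore {l : ℕ} (u : Fin l → Bool) (s : ℕ) : ℕ :=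
  (Finset.univ.filter fun i : Fin l => (i : ℕ) < s ∧ u i = true).card

theorem onesBefore_le {l : ℕ} (u : Fin l → Bool) (s : ℕ) : onesBefore u s ≤ l :=
  (Finset.card_le_univ _).trans (by simp)

theorem onesBefore_succ {l : ℕ} (u : Fin l → Bool) (s : Fin l) :
    onesBefore u (s + 1) = onesBefore u s + if u s = true then 1 else 0 := by
  unfold onesBefore
  split_ifs with h
  · rw [show (Finset.univ.filter fun i : Fin l => (i : ℕ) < s + 1 ∧ u i = true) =
        insert s (Finset.univ.filter fun i : Fin l => (i : ℕ) < s ∧ u i = true) from ?_,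
      Finset.card_insert_of_notMem (by simp)]
    ext i
    simp only [Finset.mem_filter, Finset.mem_univ, true_and, Finset.mem_insert, Fin.ext_iff]
    constructor
    · rintro ⟨h₁, h₂⟩
      by_cases hi : (i : ℕ) = s
      · exact Or.inl hi
      · exact Or.inr ⟨by omega, h₂⟩
    · rintro (hi | ⟨h₁, h₂⟩)
      · exact ⟨by omega, by rwa [Fin.ext hi]⟩
      · exact ⟨by omega, h₂⟩
  · rw [add_zero]
    congr 1
    ext i
    simp only [Finset.mem_filter, Finset.mem_univ, true_and]
    constructor
    · rintro ⟨h₁, h₂⟩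
      have hi : (i : ℕ) ≠ s := fun hi => h (by rwa [← Fin.ext hi])
      exact ⟨by omega, h₂⟩
    · rintro ⟨h₁, h₂⟩
      exact ⟨by omega, h₂⟩

/-- Given `N` clusters of `l + 1` elements and, for each of them, a word of `l` bits, the clusters
can be placed disjointly so that consecutive elements of a cluster are at distance `1` or `m + 1`
according to the bits: translates by multiples of `m` of clusters with the same word fill the
rows of a band of `l + 1` consecutive residues modulo `m`. -/
theorem exists_placement {l m N B T : ℕ} (hT : 0 < T) (hB : B * (l + 1) ≤ m)
    (h : N + 2 ^ l * T ≤ B * T) (w : Fin N → Fin l → Bool) :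
    ∃ p : Fin N × Fin (l + 1) → Fin (m * (T + l)), Function.Injective p ∧
      ∀ j (s : Fin l), (p (j, s.succ) : ℕ) =
        p (j, s.castSucc) + (1 + m * if w j s = true then 1 else 0) := by
  obtain ⟨g, hg, hgw⟩ := exists_packing (S := Fin l → Bool) hT (by simpa using h) w
  -- Boxes are bands of `l + 1` columns; the slot is the starting row.
  let col : Fin N × Fin (l + 1) → ℕ := fun x => x.2 + (l + 1) * (g x.1).1
  let row : Fin N × Fin (l + 1) → ℕ := fun x => onesBefore (w x.1) x.2 + (g x.1).2
  have hcol : ∀ x, col x < m := fun x => by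
    have h₁ : (l + 1) * (((g x.1).1 : ℕ) + 1) ≤ (l + 1) * B := Nat.mul_le_mul_left _ (g x.1).1.2
    have h₂ := x.2.2
    simp only [col]
    rw [Nat.mul_comm] at hB
    rw [Nat.mul_add] at h₁
    omega
  have hrow : ∀ x, row x < T + l := fun x => by
    have h₁ := onesBefore_le (w x.1) x.2
    have h₂ := (g x.1).2.2
    simp only [row]
    omega
  have hlt : ∀ x, col x + m * row x < m * (T + l) := fun x => by
    have h₁ : m * (row x + 1) ≤ m * (T + l) := Nat.mul_le_mul_left _ (hrow x)
    have h₂ := hcol x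
    rw [Nat.mul_add] at h₁
    omega
  refine ⟨fun x => ⟨col x + m * row x, hlt x⟩, ?_, ?_⟩
  · intro x y hxy
    have hxy : col x + m * row x = col y + m * row y := congrArg Fin.val hxy
    have hm : 0 < m := (Nat.zero_le _).trans_lt (hcol x)
    have hc : col x = col y := by
      simpa [Nat.add_mul_mod_self_left, Nat.mod_eq_of_lt (hcol _)] using congrArg (· % m) hxy
    have hr : row x = row y := by
      rw [hc] at hxy
      exact Nat.eq_of_mul_eq_mul_left hm (Nat.add_left_cancel hxy)
    have hs : (x.2 : ℕ) = y.2 := by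
      simpa [col, Nat.add_mul_mod_self_left, Nat.mod_eq_of_lt x.2.2, Nat.mod_eq_of_lt y.2.2]
        using congrArg (· % (l + 1)) hc
    have hb : (g x.1).1 = (g y.1).1 := by
      simp only [col, hs] at hc
      exact Fin.ext (Nat.eq_of_mul_eq_mul_left l.succ_pos (Nat.add_left_cancel hc))
    -- A common box forces a common word, so the row shifts agree and cancel.
    have ht : (g x.1).2 = (g y.1).2 := by
      simp only [row, hs, hgw _ _ hb] at hr
      exact Fin.ext (Nat.add_left_cancel hr)
    exact Prod.ext (hg (Prod.ext hb ht)) (Fin.ext hs)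
  · intro j s
    simp only [col, row, Fin.val_succ, Fin.val_castSucc, onesBefore_succ]
    ring

theorem exists_perm_symm_apply_eq {α : Type*} {n : ℕ} {p q : α → Fin n}
    (hp : Function.Injective p) (hq : Function.Injective q) :
    ∃ σ : Equiv.Perm (Fin n), ∀ x, σ.symm (p x) = q x := by
  classical
  let e : {y // y ∈ Set.range p} ≃ {y // y ∈ Set.range q} :=
    (Equiv.ofInjective p hp).symm.trans (Equiv.ofInjective q hq)
  refine ⟨(Equiv.extendSubtype e).symm, fun x => ?_⟩
  rw [Equiv.symm_symm, Equiv.extendSubtype_apply_of_mem e _ ⟨x, rfl⟩]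
  have : (Equiv.ofInjective p hp).symm ⟨p x, ⟨x, rfl⟩⟩ = x :=
    (Equiv.ofInjective p hp).symm_apply_eq.2 rfl
  simp only [e, Equiv.trans_apply, this]
  rfl

/-! ### Lower bound for the growth rate -/

theorem two_pow_le_maxFamily {l k N B T : ℕ} (hk : 3 ≤ k) (hT : 0 < T)
    (hB : B * (l + 1) ≤ k - 2) (h : N + 2 ^ l * T ≤ B * T) :
    2 ^ (l * N) ≤ maxFamily ((k - 2) * (T + l)) k := by
  choose p hp hstep using fun w : Fin N → Fin l → Bool => exists_placement hT hB h w
  -- The placement for the zero word only supplies names for the cluster elements; `σ w` moves them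
  -- to their places for `w`.
  let w₀ : Fin N → Fin l → Bool := fun _ _ => false
  choose σ hσ using fun w => exists_perm_symm_apply_eq (hp w₀) (hp w)
  have key : ∀ w w' j s, w j s = false → w' j s = true → NeighborSeparated k (σ w) (σ w') := by
    intro w w' j s hw hw'
    refine ⟨p w₀ (j, s.castSucc), p w₀ (j, s.succ), Or.inl ⟨Or.inl ?_, Or.inl ?_⟩⟩
    · simp [hσ, hstep, hw]
    · simp [hσ, hstep, hw', add_comm]
  have hcard := card_le_maxFamily hk σ ?_
  · simpa [← pow_mul] using hcard
  intro w w' hne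
  obtain ⟨j, hj⟩ := Function.ne_iff.1 hne
  obtain ⟨s, hs⟩ := Function.ne_iff.1 hj
  cases hw : w j s with
  | false => exact key w w' j s hw (by simpa [hw] using hs.symm)
  | true => exact (key w' w j s (by simpa [hw] using hs.symm) hw).symm

theorem rpow_le_growthRate {l k N B T : ℕ} (hk : 3 ≤ k) (hT : 0 < T)
    (hB : B * (l + 1) ≤ k - 2) (h : N + 2 ^ l * T ≤ B * T) :
    (2 : ℝ) ^ ((l * N : ℝ) / ((k - 2 : ℕ) * (T + l))) ≤ growthRate k := by
  have hn : (k - 2) * (T + l) ≠ 0 := Nat.mul_ne_zero (by omega) (by omega)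
  refine le_trans ?_ (rootMaxFamily_le_growthRate hk hn)
  have h2 : (2 : ℝ) ^ (l * N) ≤ maxFamily ((k - 2) * (T + l)) k := by
    exact_mod_cast two_pow_le_maxFamily hk hT hB h
  calc (2 : ℝ) ^ ((l * N : ℝ) / ((k - 2 : ℕ) * (T + l)))
      = ((2 : ℝ) ^ (l * N)) ^ (1 / (((k - 2) * (T + l) : ℕ) : ℝ)) := by
        rw [← Real.rpow_natCast, ← Real.rpow_mul zero_le_two]
        congr 1
        push_cast
        ring
    _ ≤ rootMaxFamily k ((k - 2) * (T + l)) :=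
        Real.rpow_le_rpow (by positivity) h2 (by positivity)

theorem eventually_rpow_le_growthRate (l : ℕ) :
    ∀ᶠ m : ℕ in atTop, (2 : ℝ) ^ ((l : ℝ) * ((m / (l + 1 : ℕ) : ℕ) - (2 : ℝ) ^ l) / (m + l)) ≤
      growthRate (m + 2) := by
  filter_upwards [eventually_ge_atTop (2 ^ l * (l + 1) + 1)] with m hm
  have hm0 : 0 < m := by omega
  set B := m / (l + 1) with hBdef
  have hB2 : 2 ^ l ≤ B := (Nat.le_div_iff_mul_le l.succ_pos).2 (Nat.le_of_succ_le hm)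
  -- With `T = m` the `l` spare rows are negligible, and this `N` gives equality in the packing
  -- condition.
  have h := rpow_le_growthRate (l := l) (k := m + 2) (N := (B - 2 ^ l) * m) (B := B) (T := m)
    (by omega) hm0 (by simpa using Nat.div_mul_le_self m (l + 1))
    (by rw [← Nat.add_mul, Nat.sub_add_cancel hB2])
  convert h using 2
  have hm0' : (m : ℝ) ≠ 0 := by exact_mod_cast hm0.ne'
  have hml : (m : ℝ) + l ≠ 0 := by positivity
  rw [Nat.add_sub_cancel]
  push_cast [Nat.cast_sub hB2]
  field_simp

theorem tendsto_exponent (l : ℕ) :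
    Tendsto (fun m : ℕ => (l : ℝ) * ((m / (l + 1 : ℕ) : ℕ) - (2 : ℝ) ^ l) / (m + l)) atTop
      (𝓝 ((l : ℝ) / (l + 1))) := by
  have hl : (0 : ℝ) < (l : ℝ) + 1 := by positivity
  have hinv : Tendsto (fun m : ℕ => ((m : ℝ) + l)⁻¹) atTop (𝓝 0) :=
    tendsto_inv_atTop_zero.comp (tendsto_atTop_add_const_right _ _ tendsto_natCast_atTop_atTop)
  have hlim : ∀ C : ℝ, Tendsto (fun m : ℕ => (l : ℝ) / (l + 1) - C * ((m : ℝ) + l)⁻¹) atTop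
      (𝓝 ((l : ℝ) / (l + 1))) := fun C => by
    simpa using tendsto_const_nhds.sub (hinv.const_mul C)
  -- The constant comes from bounding the floor below by `m / (l + 1) - 1` and writing `m = (m + l)
  -- - l`.
  refine tendsto_of_tendsto_of_tendsto_of_le_of_le'
    (hlim (l * (l / (l + 1) + 1 + 2 ^ l))) (hlim 0) ?_ ?_
  · filter_upwards [eventually_gt_atTop 0] with m hm
    have hm' : (0 : ℝ) < m := by exact_mod_cast hm
    have hml : (0 : ℝ) < m + l := by positivity
    have hfl : (m : ℝ) / (l + 1) - 1 ≤ (m / (l + 1 : ℕ) : ℕ) := by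
      have : (m : ℝ) < ((m / (l + 1) : ℕ) + 1) * (l + 1) := by
        have h : m < (m / (l + 1) + 1) * (l + 1) := by
          rw [Nat.add_mul, one_mul]
          exact Nat.lt_div_mul_add l.succ_pos
        exact_mod_cast h
      rw [sub_le_iff_le_add, div_le_iff₀ hl]
      exact this.le
    calc (l : ℝ) / (l + 1) - l * (l / (l + 1) + 1 + 2 ^ l) * ((m : ℝ) + l)⁻¹
        = l * (m / (l + 1) - 1 - 2 ^ l) / (m + l) := by field_simp; ring
      _ ≤ _ := by gcongr
  · filter_upwards [eventually_gt_atTop 0] with m hm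
    have hm' : (0 : ℝ) < m := by exact_mod_cast hm
    have hml : (0 : ℝ) < m + l := by positivity
    have hfl : ((m / (l + 1 : ℕ) : ℕ) : ℝ) ≤ m / (l + 1) := by
      simpa using (Nat.cast_div_le (α := ℝ) (m := m) (n := l + 1))
    have hsub : ((m / (l + 1 : ℕ) : ℕ) : ℝ) - 2 ^ l ≤ (m + l) / (l + 1) := by
      have h₁ : (m : ℝ) / (l + 1) ≤ (m + l) / (l + 1) := by gcongr; simp
      have h₂ : (0 : ℝ) ≤ 2 ^ l := by positivity
      linarith
    calc (l : ℝ) * ((m / (l + 1 : ℕ) : ℕ) - (2 : ℝ) ^ l) / (m + l)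
        ≤ l * ((m + l) / (l + 1)) / (m + l) := by gcongr
      _ = l / (l + 1) - 0 * ((m : ℝ) + l)⁻¹ := by field_simp; ring

theorem rpow_le_liminf_growthRate (l : ℕ) :
    (((2 : ℝ) ^ ((l : ℝ) / (l + 1)) : ℝ) : EReal) ≤
      liminf (fun k : ℕ => ((growthRate k : ℝ) : EReal)) atTop := by
  have hlim : Tendsto
      (fun m : ℕ => (((2 : ℝ) ^ ((l : ℝ) * ((m / (l + 1 : ℕ) : ℕ) - (2 : ℝ) ^ l) / (m + l)) : ℝ) :
        EReal)) atTop (𝓝 (((2 : ℝ) ^ ((l : ℝ) / (l + 1)) : ℝ) : EReal)) :=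
    (continuous_coe_real_ereal.tendsto _).comp
      (tendsto_const_nhds.rpow (tendsto_exponent l) (Or.inl two_ne_zero))
  rw [← liminf_nat_add _ 2, ← hlim.liminf_eq]
  refine liminf_le_liminf ?_
  filter_upwards [eventually_rpow_le_growthRate l] with m hm
  exact_mod_cast hm

end NeighborSep

theorem theorem5p3 :
    (∀ k : ℕ, 3 ≤ k →
      Filter.Tendsto (NeighborSep.rootMaxFamily k) Filter.atTop
        (nhds (NeighborSep.growthRate k))) ∧
    (2 : EReal) ≤
      Filter.liminf (fun k : ℕ => ((NeighborSep.growthRate k : ℝ) : EReal)) Filter.atTop := by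
  refine ⟨fun k hk => NeighborSep.tendsto_rootMaxFamily hk, ?_⟩
  have hlim : Filter.Tendsto (fun l : ℕ => (((2 : ℝ) ^ ((l : ℝ) / (l + 1)) : ℝ) : EReal))
      Filter.atTop (nhds (((2 : ℝ) ^ (1 : ℝ) : ℝ) : EReal)) :=
    (continuous_coe_real_ereal.tendsto _).comp
      (tendsto_const_nhds.rpow (tendsto_natCast_div_add_atTop (1 : ℝ)) (Or.inl two_ne_zero))
  rw [Real.rpow_one] at hlim
  exact le_of_tendsto' hlim NeighborSep.rpow_le_liminf_growthRate
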